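/- Let $X$ be a locally Noetherian scheme. For a quasi-coherent $\mathcal O_X$-module $\mathcal H$, let $\mathrm{Ass}(\mathcal H)$ be the set of points $x\in X$ for which there is a germ $s\in\mathcal H_x$ whose annihilator in $\mathcal O_{X,x}$ is the maximal ideal $\mathfrak m_x$. For points $\mathfrak q,\mathfrak p\in X$ write $\mathfrak q<\mathfrak p$ if $\overline{\{\mathfrak p\}}\subsetneq\overline{\{\mathfrak q\}}$. Let $\mathcal F$ be a (necessarily non-zero) quasi-coherent $\mathcal O_X$-module, and let $\mathfrak p\in\mathrm{Ass}(\mathcal F)$ be minimal, i.e. no $\mathfrak q\in\mathrm{Ass}(\mathcal F)$ satisfies $\mathfrak q<\mathfrak p$. Let $i:\mathrm{Spec}(\mathcal O_{X,\mathfrak p})\to X$ be the canonical morphism, and let $\mathcal F\to i_*i^*\mathcal F$ be the adjunction morphism. Let $\mathcal G$ be a quasi-coherent $\mathcal O_X$-submodule of $\mathcal F$. Then $$\mathcal G=\ker(\mathcal F\to i_*i^*\mathcal F)$$ if and only if both $\mathrm{Ass}(\mathcal F/\mathcal G)=\{\mathfrak p\}$ and $\mathrm{Ass}(\mathcal G)=\mathrm{Ass}(\mathcal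 F)\setminus\{\mathfrak p\}$ hold. -/

import Mathlib

universe u

open CategoryTheory CategoryTheory.Limits AlgebraicGeometry

/-- The `𝒪_{X,x}`-module structure on the stalk `F_x` of an `𝒪_X`-module. -/
noncomputable instance stalkModule {X : Scheme.{u}} (F : X.Modules) (x : X) :
    Module (X.presheaf.stalk x) (F.presheaf.stalk x) :=
  PresheafOfModules.instModuleCarrierStalkCommRingCatCarrierAbPresheafOpensCarrier
    (R := X.presheaf) F.val x

/-- The module structure on stalks is the one induced by the sections. -/
theorem stalkModule_germ_smul {X : Scheme.{u}} (F : X.Modules) (x : X) (U : X.Opens) (hx : x ∈ U)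
    (r : Γ(X, U)) (m : Γ(F, U)) :
    F.presheaf.germ U x hx (r • m) = X.presheaf.germ U x hx r • F.presheaf.germ U x hx m :=
  PresheafOfModules.germ_smul (R := X.presheaf) F.val x U hx r m

/-- `x` is an associated point of the `𝒪_X`-module `F` if some germ `s ∈ F_x` has annihilator
`Ann(s) = {a ∈ 𝒪_{X,x} | a • s = 0}` equal to the maximal ideal of `𝒪_{X,x}`. -/
def IsAssociatedPoint {X : Scheme.{u}} (F : X.Modules) (x : X) : Prop :=
  ∃ s : F.presheaf.stalk x,
    Ideal.torsionOf (X.presheaf.stalk x) (F.presheaf.stalk x) s =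
      IsLocalRing.maximalIdeal (X.presheaf.stalk x)

/-- `Ass(F)`, the set of associated points of `F`. -/
def Ass {X : Scheme.{u}} (F : X.Modules) : Set X :=
  {x | IsAssociatedPoint F x}

/-- The strict order on the points of a scheme: `q < p` if `closure {p}` is strictly contained
in `closure {q}`. -/
def PointLT {X : Scheme.{u}} (q p : X) : Prop :=
  closure ({p} : Set X) ⊂ closure ({q} : Set X)

/-- `p` is a minimal element of `Ass(F)` for the order `PointLT`. -/
def IsMinimalAssociatedPoint {X : Scheme.{u}} (F : X.Modules) (p : X) : Prop :=
  p ∈ Ass F ∧ ∀ q ∈ Ass F, ¬ PointLT q p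

/-- The canonical morphism `F ⟶ i_* i^* F`, where `i : Spec 𝒪_{X,p} ⟶ X` is the canonical
morphism: the unit of the adjunction between `i^*` and `i_*`. -/
noncomputable def toPushforwardPullbackStalk {X : Scheme.{u}} (F : X.Modules) (p : X) :
    F ⟶ (Scheme.Modules.pushforward (X.fromSpecStalk p)).obj
      ((Scheme.Modules.pullback (X.fromSpecStalk p)).obj F) :=
  (Scheme.Modules.pullbackPushforwardAdjunction (X.fromSpecStalk p)).unit.app F

/-! Everything rests on one fact: a nonzero germ at `x` of a quasi-coherent module on a locally
Noetherian scheme stays nonzero at some associated point `q ⤳ x`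
(`exists_mem_Ass_stalkSpecializes_ne_zero`). If `p` is a minimal associated point, a section with
zero germ at `p` therefore has zero germ at every generization of `p`, so the kernel `K` of `F ⟶ i_*
i^* F` consists of the sections with zero germ at `p`
(`toPushforwardPullbackStalk_app_eq_zero_iff`).

Hence `K_x` is the kernel of `F_x → F_p` if `p ⤳ x`, and all of `F_x` otherwise. So `(F/K)_x` embeds
in `F_p` or is zero. For `x ≠ p` with `p ⤳ x`, some element of the maximal ideal at `x` acts
invertibly on `F_p`, and both formulas for `Ass` follow.

Conversely, if the `Ass` conditions hold, `G_p = 0` by minimality of `p`, so `G ≤ K`; and a section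
of `K` maps to a section of `F/G` with zero germ at `p`, the only associated point of `F/G`, hence
to zero. -/

namespace AlgebraicGeometry.Scheme.Modules

open TopologicalSpace Opposite

variable {X Y : Scheme.{u}}

/-! ### Sections, germs and maps on stalks. -/

/-- Sections over an open subset, as a functor to abelian groups. -/
noncomputable def sectionsFunctor (U : X.Opens) : X.Modules ⥤ Ab.{u} :=
  toPresheaf X ⋙ (CategoryTheory.evaluation _ _).obj (op U)

noncomputable instance (U : X.Opens) : PreservesLimits (sectionsFunctor U) :=
  have : PreservesLimits ((CategoryTheory.evaluation X.Opensᵒᵖ Ab.{u}).obj (op U)) :=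
    ⟨inferInstance⟩
  comp_preservesLimits _ _

instance (U : X.Opens) : (sectionsFunctor U).Additive where
  map_add := rfl

lemma app_injective {F G : X.Modules} (φ : F ⟶ G) [Mono φ] (U : X.Opens) :
    Function.Injective (φ.app U) := by
  have : Mono ((sectionsFunctor U).map φ) := inferInstance
  exact (AddCommGrpCat.mono_iff_injective ((sectionsFunctor U).map φ)).mp this

/-- Taking sections is left exact. -/
lemma exists_app_eq_of_app_eq_zero {S : ShortComplex X.Modules} (hS : S.Exact) [Mono S.f]
    {U : X.Opens} (s : Γ(S.X₂, U)) (hs : S.g.app U s = 0) : ∃ t : Γ(S.X₁, U), S.f.app U t = s := by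
  have h := hS.map_of_mono_of_preservesKernel (sectionsFunctor U) inferInstance inferInstance
  exact (ShortComplex.ab_exact_iff _).mp h s hs

lemma app_map {F G : X.Modules} (φ : F ⟶ G) {U V : X.Opens} (i : U ⟶ V) (s : Γ(F, V)) :
    φ.app U (F.presheaf.map i.op s) = G.presheaf.map i.op (φ.app V s) :=
  ConcreteCategory.congr_hom (φ.mapPresheaf.naturality i.op) s

/-- A section which vanishes locally vanishes. -/
lemma eq_zero_of_locally_eq_zero (F : X.Modules) {U : X.Opens} (s : Γ(F, U))
    (h : ∀ x ∈ U, ∃ (V : X.Opens) (i : V ⟶ U), x ∈ V ∧ F.presheaf.map i.op s = 0) : s = 0 := by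
  apply TopCat.Presheaf.IsSheaf.section_ext F.isSheaf
  intro x hx
  obtain ⟨V, i, hxV, hs⟩ := h x hx
  refine ⟨V, leOfHom i, hxV, ?_⟩
  rw [map_zero]
  exact hs

lemma exists_map_eq_zero_of_germ_eq_zero (F : X.Modules) {U : X.Opens} (s : Γ(F, U)) {x : X}
    (hx : x ∈ U) (h : F.presheaf.germ U x hx s = 0) :
    ∃ (V : X.Opens) (i : V ⟶ U), x ∈ V ∧ F.presheaf.map i.op s = 0 := by
  obtain ⟨V, hxV, i, j, e⟩ := F.presheaf.germ_eq x hx hx s 0 (by rw [h, map_zero])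
  exact ⟨V, i, hxV, by rw [e, map_zero]⟩

lemma eq_zero_of_germ_eq_zero (F : X.Modules) {U : X.Opens} (s : Γ(F, U))
    (h : ∀ x (hx : x ∈ U), F.presheaf.germ U x hx s = 0) : s = 0 :=
  eq_zero_of_locally_eq_zero F s fun x hx ↦ exists_map_eq_zero_of_germ_eq_zero F s hx (h x hx)

lemma exists_germ_eq_germ_eq (F : X.Modules) {x : X} (a : X.presheaf.stalk x)
    (s : F.presheaf.stalk x) :
    ∃ (U : X.Opens) (hx : x ∈ U) (a' : Γ(X, U)) (s' : Γ(F, U)),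
      X.presheaf.germ U x hx a' = a ∧ F.presheaf.germ U x hx s' = s := by
  obtain ⟨U, hxU, a, rfl⟩ := X.presheaf.exists_germ_eq a
  obtain ⟨V, hxV, s, rfl⟩ := F.presheaf.exists_germ_eq s
  exact ⟨U ⊓ V, ⟨hxU, hxV⟩, X.presheaf.map (homOfLE inf_le_left).op a,
    F.presheaf.map (homOfLE inf_le_right).op s, X.presheaf.germ_res_apply _ _ _ _,
    F.presheaf.germ_res_apply _ _ _ _⟩

/-- The map on stalks induced by a morphism of modules. -/
noncomputable def stalkHom {F G : X.Modules} (φ : F ⟶ G) (x : X) :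
    F.presheaf.stalk x →ₗ[X.presheaf.stalk x] G.presheaf.stalk x where
  toFun := (TopCat.Presheaf.stalkFunctor Ab x).map φ.mapPresheaf
  map_add' := map_add _
  map_smul' a s := by
    obtain ⟨U, hx, a, s, rfl, rfl⟩ := exists_germ_eq_germ_eq F a s
    have key (t : Γ(F, U)) : (TopCat.Presheaf.stalkFunctor Ab x).map φ.mapPresheaf
        (F.presheaf.germ U x hx t) = G.presheaf.germ U x hx (φ.app U t) :=
      TopCat.Presheaf.stalkFunctor_map_germ_apply U x hx φ.mapPresheaf t
    rw [← stalkModule_germ_smul]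
    refine (key _).trans ?_
    rw [Hom.app_smul, stalkModule_germ_smul, ← key]
    rfl

@[simp]
lemma stalkHom_germ {F G : X.Modules} (φ : F ⟶ G) {U : X.Opens} {x : X} (hx : x ∈ U)
    (s : Γ(F, U)) :
    stalkHom φ x (F.presheaf.germ U x hx s) = G.presheaf.germ U x hx (φ.app U s) :=
  TopCat.Presheaf.stalkFunctor_map_germ_apply U x hx φ.mapPresheaf s

lemma stalkHom_injective {F G : X.Modules} (φ : F ⟶ G) [Mono φ] (x : X) :
    Function.Injective (stalkHom φ x) := by
  rw [← LinearMap.ker_eq_bot, LinearMap.ker_eq_bot']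
  intro s hs
  obtain ⟨U, hxU, s, rfl⟩ := F.presheaf.exists_germ_eq s
  rw [stalkHom_germ] at hs
  obtain ⟨V, i, hxV, e⟩ := exists_map_eq_zero_of_germ_eq_zero _ _ hxU hs
  rw [← app_map] at e
  rw [← F.presheaf.germ_res_apply i x hxV, app_injective φ V (e.trans (map_zero _).symm), map_zero]

lemma exists_stalkHom_eq_of_stalkHom_eq_zero {S : ShortComplex X.Modules} (hS : S.Exact)
    [Mono S.f] {x : X} (s : S.X₂.presheaf.stalk x) (hs : stalkHom S.g x s = 0) :
    ∃ t, stalkHom S.f x t = s := by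
  obtain ⟨U, hxU, s, rfl⟩ := S.X₂.presheaf.exists_germ_eq s
  rw [stalkHom_germ] at hs
  obtain ⟨V, i, hxV, e⟩ := exists_map_eq_zero_of_germ_eq_zero _ _ hxU hs
  rw [← app_map] at e
  obtain ⟨t, ht⟩ := exists_app_eq_of_app_eq_zero hS _ e
  exact ⟨S.X₁.presheaf.germ V x hxV t, by rw [stalkHom_germ, ht, S.X₂.presheaf.germ_res_apply]⟩

/-- The specialization map between stalks, semilinear over the one of the structure sheaf. -/
noncomputable def stalkSpecializes (F : X.Modules) {x y : X} (h : x ⤳ y) :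
    F.presheaf.stalk y →ₛₗ[(X.presheaf.stalkSpecializes h).hom] F.presheaf.stalk x where
  toFun := F.presheaf.stalkSpecializes h
  map_add' := map_add _
  map_smul' a s := by
    obtain ⟨U, hx, a, s, rfl, rfl⟩ := exists_germ_eq_germ_eq F a s
    have key (t : Γ(F, U)) : F.presheaf.stalkSpecializes h (F.presheaf.germ U y hx t) =
        F.presheaf.germ U x (h.mem_open U.isOpen hx) t :=
      ConcreteCategory.congr_hom (F.presheaf.germ_stalkSpecializes hx h) t
    have key' : X.presheaf.stalkSpecializes h (X.presheaf.germ U y hx a) =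
        X.presheaf.germ U x (h.mem_open U.isOpen hx) a :=
      ConcreteCategory.congr_hom (X.presheaf.germ_stalkSpecializes hx h) a
    rw [← stalkModule_germ_smul]
    refine (key _).trans ?_
    rw [stalkModule_germ_smul, ← key, ← key']

@[simp]
lemma stalkSpecializes_germ (F : X.Modules) {x y : X} (h : x ⤳ y) {U : X.Opens} (hy : y ∈ U)
    (s : Γ(F, U)) :
    stalkSpecializes F h (F.presheaf.germ U y hy s) =
      F.presheaf.germ U x (h.mem_open U.isOpen hy) s :=
  ConcreteCategory.congr_hom (F.presheaf.germ_stalkSpecializes hy h) s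

/-! ### Skyscraper modules and the unit of the pullback-pushforward adjunction. -/

section Skyscraper

variable (y : X) (N : Type u) [AddCommGroup N] [Module (X.presheaf.stalk y) N]

/-- The presheaf of abelian groups `U ↦ (y ∈ U → N)`. -/
def skyscraperAb (y : X) (N : Type u) [AddCommGroup N] : TopCat.Presheaf Ab.{u} X where
  -- Functions on proofs of `y ∈ U` give `N` or the zero group without a case distinction.
  obj U := AddCommGrpCat.of (PLift (y ∈ U.unop) → N)
  map {_ _} i := AddCommGrpCat.ofHom
    { toFun := fun s h ↦ s ⟨leOfHom i.unop h.down⟩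
      map_zero' := rfl
      map_add' := fun _ _ ↦ rfl }

lemma skyscraperAb_isSheaf (y : X) (N : Type u) [AddCommGroup N] :
    (skyscraperAb y N).IsSheaf := by
  rw [TopCat.Presheaf.isSheaf_iff_isSheaf_comp (CategoryTheory.forget AddCommGrpCat)]
  apply TopCat.Presheaf.isSheaf_of_isSheafUniqueGluing_types
  intro ι U s hs
  have hU (h : y ∈ iSup U) : ∃ i, y ∈ U i := Opens.mem_iSup.mp h
  refine ⟨fun h ↦ (s (hU h.down).choose : PLift (y ∈ _) → N) ⟨(hU h.down).choose_spec⟩, fun i ↦ ?_, fun t ht ↦ ?_⟩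
  · funext h
    have h' : y ∈ iSup U := Opens.mem_iSup.mpr ⟨i, h.down⟩
    exact congrFun (hs (hU h').choose i) ⟨⟨(hU h').choose_spec, h.down⟩⟩
  · funext h
    exact congrFun (ht (hU h.down).choose) ⟨(hU h.down).choose_spec⟩

noncomputable instance (U : (Opens X)ᵒᵖ) :
    Module (X.ringCatSheaf.obj.obj U) ((skyscraperAb y N).obj U) :=
  letI (h : PLift (y ∈ U.unop)) : Module (X.presheaf.obj U) N :=
    Module.compHom N (X.presheaf.germ U.unop y h.down).hom
  inferInstanceAs (Module (X.presheaf.obj U) (PLift (y ∈ U.unop) → N))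

/-- The skyscraper sheaf of modules at `y` with value the `𝒪_{X,y}`-module `N`. -/
noncomputable def skyscraper : X.Modules where
  val := PresheafOfModules.ofPresheaf (skyscraperAb y N) (by
    intro U V f r m
    funext h
    refine congrArg (fun a : X.presheaf.stalk y ↦ a • (m ⟨leOfHom f.unop h.down⟩ : N)) ?_
    exact (X.presheaf.germ_res_apply' f y h.down r).symm)
  isSheaf := skyscraperAb_isSheaf y N

end Skyscraper

variable {M : Y.Modules}

/-- The morphism to the pushforward of a skyscraper sheaf determined by a semilinear map on the
stalk. -/
noncomputable def toPushforwardSkyscraper (f : X ⟶ Y) (x : X) (N : Type u) [AddCommGroup N]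
    [Module (X.presheaf.stalk x) N]
    (g : M.presheaf.stalk (f x) →ₛₗ[(f.stalkMap x).hom] N) :
    M ⟶ (pushforward f).obj (skyscraper x N) where
  val :=
    { app := fun U ↦ ModuleCat.ofHom (Y := ((pushforward f).obj (skyscraper x N)).val.obj U)
        { toFun := fun s h ↦ g (M.presheaf.germ U.unop (f x) h.down s)
          map_add' := fun s t ↦ by
            funext h
            exact (congrArg g (map_add (M.presheaf.germ U.unop (f x) h.down).hom s t)).trans
              (map_add g _ _)
          map_smul' := fun r s ↦ by
            funext h
            refine (congrArg g (stalkModule_germ_smul M (f x) U.unop h.down r s)).trans ?_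
            rw [map_smulₛₗ]
            refine congrArg (· • _) ?_
            exact f.germ_stalkMap_apply U.unop x h.down r }
      naturality := by
        intro U V i
        ext s
        funext h
        exact congrArg g (M.presheaf.germ_res_apply' i (f x) h.down s) }

/-- A module over the stalk at `f x`, viewed as a module over the stalk at `x` when `f` induces an
isomorphism of stalks. -/
noncomputable abbrev moduleOfIsIsoStalkMap (f : X ⟶ Y) (x : X) [IsIso (f.stalkMap x)]
    (N : Type u) [AddCommGroup N] [Module (Y.presheaf.stalk (f x)) N] :
    Module (X.presheaf.stalk x) N :=
  Module.compHom N (inv (f.stalkMap x)).hom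

lemma stalkMap_smul_of_isIso (f : X ⟶ Y) (x : X) [IsIso (f.stalkMap x)]
    (N : Type u) [AddCommGroup N] [Module (Y.presheaf.stalk (f x)) N]
    (a : Y.presheaf.stalk (f x)) (n : N) :
    letI := moduleOfIsIsoStalkMap f x N
    (f.stalkMap x).hom a • n = a • n := by
  refine congrArg (fun b : Y.presheaf.stalk (f x) ↦ b • n) ?_
  exact ConcreteCategory.congr_hom (IsIso.hom_inv_id (f.stalkMap x)) a

/-- Morphisms into pushed-forward skyscrapers detect germs at `f x`, which makes a computation of
the stalks of `f^* M` unnecessary. -/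
lemma exists_toPushforward_app_eq_zero_iff (f : X ⟶ Y) (x : X) [IsIso (f.stalkMap x)]
    {M : Y.Modules} {N : Type u} [AddCommGroup N] [Module (Y.presheaf.stalk (f x)) N]
    (g : M.presheaf.stalk (f x) →ₗ[Y.presheaf.stalk (f x)] N) :
    ∃ (S : X.Modules) (ψ : M ⟶ (pushforward f).obj S), ∀ (U : Y.Opens) (s : Γ(M, U)),
      ψ.app U s = 0 ↔ ∀ h : f x ∈ U, g (M.presheaf.germ U (f x) h s) = 0 := by
  let := moduleOfIsIsoStalkMap f x N
  refine ⟨skyscraper x N, toPushforwardSkyscraper f x N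
    { toFun := g
      map_add' := map_add g
      map_smul' := fun a m ↦ (g.map_smul a m).trans (stalkMap_smul_of_isIso f x N a (g m)).symm }, fun U s ↦
      ⟨fun h hx ↦ ?_, fun h ↦ ?_⟩⟩
  · exact congrFun (a := ⟨hx⟩) h
  · funext hx
    exact h hx.down

/-- If the unit of the pullback-pushforward adjunction kills a section, then its germs vanish at
the image of every point at which the stalk map is an isomorphism. -/
lemma germ_eq_zero_of_unit_app_eq_zero (f : X ⟶ Y) (x : X) [IsIso (f.stalkMap x)]
    {M : Y.Modules} {U : Y.Opens} (s : Γ(M, U))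
    (hs : ((pullbackPushforwardAdjunction f).unit.app M).app U s = 0) (h : f x ∈ U) :
    M.presheaf.germ U (f x) h s = 0 := by
  obtain ⟨S, ψ, hψ⟩ := exists_toPushforward_app_eq_zero_iff f x
    (LinearMap.id (R := Y.presheaf.stalk (f x)) (M := M.presheaf.stalk (f x)))
  refine (hψ U s).mp ?_ h
  -- By adjunction `ψ` factors through the unit, so it kills whatever the unit kills.
  have e : ψ = (pullbackPushforwardAdjunction f).unit.app M ≫
      (pushforward f).map (((pullbackPushforwardAdjunction f).homEquiv M S).symm ψ) :=
    (Equiv.apply_symm_apply _ ψ).symm.trans (Adjunction.homEquiv_unit _ _ _ _)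
  rw [e, Hom.comp_app, AddCommGrpCat.comp_apply, hs, map_zero]

/-- The unit of the pullback-pushforward adjunction kills a section whose germs at the points of
the image vanish. -/
lemma unit_app_eq_zero_of_germ_eq_zero (f : X ⟶ Y) {M : Y.Modules} {U : Y.Opens} (s : Γ(M, U))
    (hs : ∀ x (h : f x ∈ U), M.presheaf.germ U (f x) h s = 0) :
    ((pullbackPushforwardAdjunction f).unit.app M).app U s = 0 := by
  refine eq_zero_of_locally_eq_zero ((pullback f).obj M) (U := f ⁻¹ᵁ U) _ fun x hx ↦ ?_
  obtain ⟨V, i, hxV, e⟩ := exists_map_eq_zero_of_germ_eq_zero M s (x := f x) hx (hs x hx)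
  refine ⟨f ⁻¹ᵁ V, (Opens.map f.base).map i, hxV, ?_⟩
  refine (app_map ((pullbackPushforwardAdjunction f).unit.app M) i s).symm.trans ?_
  exact (congrArg (((pullbackPushforwardAdjunction f).unit.app M).app V) e).trans (map_zero _)

/-- The cokernel of the stalk map, placed as a skyscraper at `x`, receives a morphism from `G` that
vanishes on `F`. It is zero because `φ` is epi, so every germ of `G` lies in the range. -/
lemma stalkHom_surjective {F G : X.Modules} (φ : F ⟶ G) [Epi φ] (x : X) :
    Function.Surjective (stalkHom φ x) := by
  obtain ⟨y, hy⟩ : ∃ y : X, (𝟙 X : X ⟶ X) y = x := ⟨x, by simp⟩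
  subst hy
  obtain ⟨S, ψ, hψ⟩ := exists_toPushforward_app_eq_zero_iff (𝟙 X) y
    (LinearMap.range (stalkHom φ ((𝟙 X : X ⟶ X) y))).mkQ
  have h0 : ψ = 0 := by
    rw [← cancel_epi φ, comp_zero]
    ext U s
    refine (hψ U _).mpr fun h ↦ ?_
    rw [Submodule.mkQ_apply, Submodule.Quotient.mk_eq_zero]
    exact ⟨_, stalkHom_germ φ h s⟩
  intro t
  obtain ⟨U, hU, t, rfl⟩ := G.presheaf.exists_germ_eq t
  have := (hψ U t).mp (by rw [h0]; rfl) hU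
  rwa [Submodule.mkQ_apply, Submodule.Quotient.mk_eq_zero] at this

instance isIso_stalkMap_fromSpecStalk (X : Scheme.{u}) (x : X) :
    IsIso ((X.fromSpecStalk x).stalkMap (IsLocalRing.closedPoint (X.presheaf.stalk x))) := by
  have : IsIso (stalkClosedPointTo (X.fromSpecStalk x)) := by
    rw [stalkClosedPointTo_fromSpecStalk]; infer_instance
  rw [stalkClosedPointTo] at this
  exact IsIso.of_isIso_comp_right _ (stalkClosedPointIso (X.presheaf.stalk x)).hom

/-! ### Quasi-coherent modules on affine opens: localization of sections. -/

lemma _root_.AlgebraicGeometry.IsAffineOpen.ΓSpecIso_inv_comp_map_comp_appIso_inv {U : X.Opens}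
    (hU : IsAffineOpen U) (V : (Spec Γ(X, U)).Opens) (h : hU.fromSpec ''ᵁ V ≤ U) :
    (Scheme.ΓSpecIso Γ(X, U)).inv ≫ (Spec Γ(X, U)).presheaf.map V.leTop.op ≫
      (hU.fromSpec.appIso V).inv = X.presheaf.map (homOfLE h).op := by
  rw [← Category.assoc, Iso.comp_inv_eq, Scheme.Hom.appIso_hom, Scheme.Hom.naturality_assoc,
    hU.fromSpec_app_self, Category.assoc, ← Functor.map_comp, ← Functor.map_comp]
  rfl

lemma Spec_smul_restrict_fromSpec (M : X.Modules) {U : X.Opens} (hU : IsAffineOpen U)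
    (V : (Spec Γ(X, U)).Opens) (h : hU.fromSpec ''ᵁ V ≤ U) (r : Γ(X, U))
    (y : Γ(M, hU.fromSpec ''ᵁ V)) :
    (r • (show Γ(M.restrict hU.fromSpec, V) from y) : Γ(M.restrict hU.fromSpec, V)) =
      (X.presheaf.map (homOfLE h).op r • y : Γ(M, hU.fromSpec ''ᵁ V)) := by
  rw [← hU.ΓSpecIso_inv_comp_map_comp_appIso_inv V h]
  rfl

lemma isLocalizedModule_restrict_fromSpec (M : X.Modules) [M.IsQuasicoherent] {U : X.Opens}
    (hU : IsAffineOpen U) (f : Γ(X, U)) :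
    IsLocalizedModule (.powers f) ((modulesSpecToSheaf.obj (M.restrict hU.fromSpec)).obj.map
      (PrimeSpectrum.basicOpen f).leTop.op).hom := by
  have h := (isIso_fromTildeΓ_iff_isLocalizing (M.restrict hU.fromSpec)).mp
    (isIso_fromTildeΓ_of_isQuasicoherent _)
  exact h f

/-- On an affine open, a section of a quasi-coherent module which vanishes on a basic open subset
`D(f)` is killed by a power of `f`. -/
lemma exists_pow_smul_eq_zero (M : X.Modules) [M.IsQuasicoherent] {U : X.Opens}
    (hU : IsAffineOpen U) (f : Γ(X, U)) (t : Γ(M, U))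
    (ht : M.presheaf.map (homOfLE (X.basicOpen_le f)).op t = 0) : ∃ n : ℕ, f ^ n • t = 0 := by
  have eT : hU.fromSpec ''ᵁ ⊤ = U := by
    rw [Scheme.Hom.image_top_eq_opensRange]; exact hU.opensRange_fromSpec
  have eD := hU.fromSpec_image_basicOpen f
  have key := isLocalizedModule_restrict_fromSpec M hU f
  -- The image of `⊤` equals `U` only propositionally, so sections are moved along restriction maps.
  let t' : Γ(M, hU.fromSpec ''ᵁ ⊤) := M.presheaf.map (homOfLE eT.le).op t
  have h0 : M.presheaf.map (homOfLE (Scheme.Hom.image_mono hU.fromSpec le_top :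
      hU.fromSpec ''ᵁ PrimeSpectrum.basicOpen f ≤ hU.fromSpec ''ᵁ ⊤)).op t' = 0 := by
    have := congrArg (M.presheaf.map (homOfLE eD.le).op) ht
    rw [map_zero] at this
    rw [← this, ← ConcreteCategory.comp_apply, ← ConcreteCategory.comp_apply, ← Functor.map_comp,
      ← Functor.map_comp]
    rfl
  obtain ⟨⟨_, n, rfl⟩, hn⟩ := key.exists_of_eq (x₁ := t') (x₂ := 0) (h0.trans (map_zero _).symm)
  rw [smul_zero] at hn
  refine ⟨n, ?_⟩
  have h1 := (Spec_smul_restrict_fromSpec M hU ⊤ eT.le (f ^ n) t').symm.trans hn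
  rw [← map_smul] at h1
  have h2 := congrArg (M.presheaf.map (homOfLE eT.ge).op) h1
  replace h2 := h2.trans (map_zero (M.presheaf.map (homOfLE eT.ge).op).hom)
  rw [← ConcreteCategory.comp_apply, ← Functor.map_comp] at h2
  rw [← h2, ← op_comp]
  exact (ConcreteCategory.congr_hom (M.presheaf.map_id (op U)) _).symm

/-- On an affine open `U`, sections of a quasi-coherent module over a basic open subset `D(f)`
extend to `U` after multiplication by a power of `f`. -/
lemma exists_map_eq_pow_smul (M : X.Modules) [M.IsQuasicoherent] {U : X.Opens}
    (hU : IsAffineOpen U) (f : Γ(X, U)) (s : Γ(M, X.basicOpen f)) :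
    ∃ (n : ℕ) (t : Γ(M, U)), M.presheaf.map (homOfLE (X.basicOpen_le f)).op t =
      X.presheaf.map (homOfLE (X.basicOpen_le f)).op (f ^ n) • s := by
  have eT : hU.fromSpec ''ᵁ ⊤ = U := by
    rw [Scheme.Hom.image_top_eq_opensRange]; exact hU.opensRange_fromSpec
  have eD := hU.fromSpec_image_basicOpen f
  have key := isLocalizedModule_restrict_fromSpec M hU f
  let s' : Γ(M, hU.fromSpec ''ᵁ PrimeSpectrum.basicOpen f) := M.presheaf.map (homOfLE eD.le).op s
  obtain ⟨⟨t, _, n, rfl⟩, ht⟩ := key.surj s'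
  refine ⟨n, M.presheaf.map (homOfLE eT.ge).op (show Γ(M, hU.fromSpec ''ᵁ ⊤) from t), ?_⟩
  have h1 := (Spec_smul_restrict_fromSpec M hU _ (eD.le.trans (X.basicOpen_le f)) (f ^ n)
    s').symm.trans ht
  have h2 := congrArg (M.presheaf.map (homOfLE eD.ge).op) h1
  have h3 : M.presheaf.map (homOfLE eD.ge).op s' = s := by
    change M.presheaf.map (homOfLE eD.ge).op (M.presheaf.map (homOfLE eD.le).op s) = s
    rw [← ConcreteCategory.comp_apply, ← Functor.map_comp]
    exact ConcreteCategory.congr_hom (M.presheaf.map_id (op _)) _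
  rw [map_smul, h3, ← ConcreteCategory.comp_apply, ← Functor.map_comp] at h2
  refine Eq.trans ?_ h2.symm
  rw [← ConcreteCategory.comp_apply, ← Functor.map_comp]
  refine Eq.trans ?_ (ConcreteCategory.comp_apply (M.presheaf.map (homOfLE
    (Scheme.Hom.image_mono hU.fromSpec (le_top : PrimeSpectrum.basicOpen f ≤ ⊤))).op)
      (M.presheaf.map (homOfLE eD.ge).op) t)
  rw [← Functor.map_comp]
  rfl

/-! ### Existence of associated points. -/

lemma germ_eq_zero_of_smul_eq_zero (H : X.Modules) {U : X.Opens} (t : Γ(H, U)) (f : Γ(X, U))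
    (h : f • t = 0) {x : X} (hx : x ∈ U) (hf : IsUnit (X.presheaf.germ U x hx f)) :
    H.presheaf.germ U x hx t = 0 := by
  rw [← hf.smul_eq_zero, ← stalkModule_germ_smul, h, map_zero]

lemma exists_mem_basicOpen_smul_eq_zero (H : X.Modules) {U : X.Opens} (hU : IsAffineOpen U)
    (t : Γ(H, U)) (ht : ∀ f : Γ(X, U), H.presheaf.map (homOfLE (X.basicOpen_le f)).op t = 0 →
      ∃ n : ℕ, f ^ n • t = 0) {x : X} (hx : x ∈ U) (h : H.presheaf.germ U x hx t = 0) :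
    ∃ f : Γ(X, U), IsUnit (X.presheaf.germ U x hx f) ∧ f • t = 0 := by
  obtain ⟨V, i, hxV, e⟩ := exists_map_eq_zero_of_germ_eq_zero H t hx h
  obtain ⟨f, hfV, hxf⟩ := hU.exists_basicOpen_le ⟨x, hxV⟩ hx
  obtain ⟨n, hn⟩ := ht f (by
    have := congrArg (H.presheaf.map (homOfLE hfV).op) e
    rw [map_zero, ← ConcreteCategory.comp_apply, ← Functor.map_comp] at this
    exact this)
  refine ⟨f ^ n, ?_, hn⟩
  rw [map_pow]
  exact ((X.mem_basicOpen f x hx).mp hxf).pow n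

/-- A nonunit of the stalk is a fraction with numerator in `Q`, so it kills the germ; a unit cannot
kill a nonzero germ. -/
lemma isAssociatedPoint_of_section (H : X.Modules) {U : X.Opens} {q : X} (hq : q ∈ U)
    (s : Γ(H, U)) (Q : Ideal Γ(X, U)) [Q.IsPrime]
    (hQ : letI := X.presheaf.algebra_section_stalk ⟨q, hq⟩
      IsLocalization.AtPrime (X.presheaf.stalk q) Q)
    (hs : ∀ a : Γ(X, U), a ∈ Q → a • s = 0) (hs' : H.presheaf.germ U q hq s ≠ 0) :
    q ∈ Ass H := by
  refine ⟨H.presheaf.germ U q hq s, ?_⟩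
  ext a
  rw [Ideal.mem_torsionOf_iff, IsLocalRing.mem_maximalIdeal, mem_nonunits_iff]
  refine ⟨fun h hu ↦ hs' (hu.smul_eq_zero.mp h), fun ha ↦ ?_⟩
  let := X.presheaf.algebra_section_stalk ⟨q, hq⟩
  obtain ⟨⟨b, c⟩, e⟩ := IsLocalization.surj Q.primeCompl a
  have hc : IsUnit (X.presheaf.germ U q hq c) := IsLocalization.map_units _ c
  have hb : b ∈ Q := by
    by_contra hb
    have : IsUnit (X.presheaf.germ U q hq b) :=
      IsLocalization.map_units (X.presheaf.stalk q) (⟨b, hb⟩ : Q.primeCompl)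
    exact ha (isUnit_of_mul_isUnit_left (e ▸ this))
  rw [← hc.smul_eq_zero, smul_smul, mul_comm]
  refine (congrArg (· • H.presheaf.germ U q hq s) e).trans ?_
  refine (stalkModule_germ_smul H q U hq b s).symm.trans ?_
  rw [hs b hb, map_zero]

/-- On a locally Noetherian scheme, a nonzero germ of a suitable section on an affine open stays
nonzero at some associated point specializing to the given point. -/
lemma exists_mem_Ass_specializes [IsLocallyNoetherian X] (H : X.Modules) {U : X.Opens}
    (hU : IsAffineOpen U) (t : Γ(H, U))
    -- The only trace of quasi-coherence needed; it can be checked directly for quotients.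
    (ht : ∀ f b : Γ(X, U), H.presheaf.map (homOfLE (X.basicOpen_le f)).op (b • t) = 0 →
      ∃ n : ℕ, f ^ n • b • t = 0) {x : X} (hx : x ∈ U) (h : H.presheaf.germ U x hx t ≠ 0) :
    ∃ (q : X) (hq : q ⤳ x), q ∈ Ass H ∧ H.presheaf.germ U q (hq.mem_open U.isOpen hx) t ≠ 0 := by
  have hN : IsNoetherianRing Γ(X, U) := IsLocallyNoetherian.component_noetherian ⟨U, hU⟩
  let I := Ideal.torsionOf Γ(X, U) Γ(H, U) t
  let x' := hU.primeIdealOf ⟨x, hx⟩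
  have hI : I ≤ x'.asIdeal := by
    intro a ha
    by_contra hax
    let := X.presheaf.algebra_section_stalk ⟨x, hx⟩
    have := hU.isLocalization_stalk ⟨x, hx⟩
    exact h (germ_eq_zero_of_smul_eq_zero H t a ha hx
      (IsLocalization.map_units (X.presheaf.stalk x) (⟨a, hax⟩ : x'.asIdeal.primeCompl)))
  -- A prime minimal over `Ann(t)` is associated to `Γ(X, U) ⧸ Ann(t)`, hence of the form `Ann(b •
  -- t)`; its point `q` is the one sought.
  obtain ⟨Q, hQ, hQx⟩ := Ideal.exists_minimalPrimes_le hI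
  have hQ' : Q ∈ associatedPrimes Γ(X, U) (Γ(X, U) ⧸ I) :=
    Module.associatedPrimes.minimalPrimes_annihilator_subset_associatedPrimes _ _
      (by rwa [Ideal.annihilator_quotient])
  obtain ⟨hQp, b, hb⟩ := isAssociatedPrime_iff.mp hQ'
  obtain ⟨b, rfl⟩ := Ideal.Quotient.mk_surjective b
  have hQb (a : Γ(X, U)) : a ∈ Q ↔ a • b • t = 0 := by
    rw [hb, Submodule.mem_colon_singleton, Submodule.mem_bot, ← smul_assoc]
    exact Ideal.Quotient.eq_zero_iff_mem (I := I) (a := a * b)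
  have hIQ : I ≤ Q := hQ.1.2
  let y : PrimeSpectrum Γ(X, U) := ⟨Q, hQp⟩
  have hyx : y ⤳ x' := (PrimeSpectrum.le_iff_specializes _ _).mp hQx
  have hq : hU.fromSpec y ⤳ x := by
    have := hyx.map hU.fromSpec.continuous
    rwa [hU.fromSpec_primeIdealOf] at this
  have hqU : hU.fromSpec y ∈ U := hq.mem_open U.isOpen hx
  let := X.presheaf.algebra_section_stalk ⟨hU.fromSpec y, hqU⟩
  have hloc : IsLocalization.AtPrime (X.presheaf.stalk (hU.fromSpec y)) Q := hU.isLocalization_stalk' y hqU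
  have hmem (f : Γ(X, U)) (hf : IsUnit (X.presheaf.germ U _ hqU f)) : f ∉ Q :=
    (IsLocalization.AtPrime.isUnit_to_map_iff (X.presheaf.stalk (hU.fromSpec y)) Q f).mp hf
  refine ⟨hU.fromSpec y, hq, isAssociatedPoint_of_section H hqU (b • t) Q hloc
    (fun a ha ↦ (hQb a).mp ha) fun h0 ↦ ?_, fun h0 ↦ ?_⟩
  -- A zero germ at `q` would yield `f ∉ Q` killing `b • t`, respectively `t`; but both annihilators
  -- lie in `Q`.
  · obtain ⟨f, hf, hft⟩ := exists_mem_basicOpen_smul_eq_zero H hU (b • t) (fun f ↦ ht f b) hqU h0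
    exact hmem f hf ((hQb f).mpr hft)
  · obtain ⟨f, hf, hft⟩ := exists_mem_basicOpen_smul_eq_zero H hU t
      (fun f hf ↦ by simpa using ht f 1 (by simpa using hf)) hqU h0
    exact hmem f hf (hIQ hft)

/-- A nonzero germ of a quasi-coherent module on a locally Noetherian scheme stays nonzero at some
associated point specializing to the given point. -/
lemma exists_mem_Ass_stalkSpecializes_ne_zero [IsLocallyNoetherian X] (H : X.Modules)
    [H.IsQuasicoherent] {x : X} (t : H.presheaf.stalk x) (ht : t ≠ 0) :
    ∃ (q : X) (hq : q ⤳ x), q ∈ Ass H ∧ stalkSpecializes H hq t ≠ 0 := by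
  obtain ⟨U, hx, hU, t, rfl⟩ := H.presheaf.exists_mem_germ_eq_of_isBasis X.isBasis_affineOpens x t
  obtain ⟨q, hq, hqA, h⟩ := exists_mem_Ass_specializes H hU t
    (fun f b hf ↦ exists_pow_smul_eq_zero H hU f _ hf) hx ht
  exact ⟨q, hq, hqA, by rwa [stalkSpecializes_germ]⟩

/-- The analogue of `exists_mem_Ass_stalkSpecializes_ne_zero` for the quotient of a quasi-coherent
module by a quasi-coherent submodule. -/
lemma exists_mem_Ass_stalkSpecializes_ne_zero_of_shortExact [IsLocallyNoetherian X]
    {S : ShortComplex X.Modules} (hS : S.ShortExact) [S.X₁.IsQuasicoherent]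
    [S.X₂.IsQuasicoherent] {x : X} (t : S.X₃.presheaf.stalk x) (ht : t ≠ 0) :
    ∃ (q : X) (hq : q ⤳ x), q ∈ Ass S.X₃ ∧ stalkSpecializes S.X₃ hq t ≠ 0 := by
  have := hS.mono_f
  have := hS.epi_g
  obtain ⟨m, rfl⟩ := stalkHom_surjective S.g x t
  obtain ⟨U, hx, hU, m, rfl⟩ :=
    S.X₂.presheaf.exists_mem_germ_eq_of_isBasis X.isBasis_affineOpens x m
  rw [stalkHom_germ] at ht ⊢
  have key (f b : Γ(X, U)) (hf : S.X₃.presheaf.map (homOfLE (X.basicOpen_le f)).op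
      (b • S.g.app U m) = 0) : ∃ n : ℕ, f ^ n • b • S.g.app U m = 0 := by
    rw [← Hom.app_smul, ← app_map] at hf
    -- On `D(f)` the section `b • m` comes from the submodule. Clearing denominators extends `f ^ n
    -- • g` to `g'` over `U`, and a further power `f ^ k` kills the difference.
    obtain ⟨g, hg⟩ := exists_app_eq_of_app_eq_zero hS.exact _ hf
    obtain ⟨n, g', hg'⟩ := exists_map_eq_pow_smul S.X₁ hU f g
    obtain ⟨k, hk⟩ := exists_pow_smul_eq_zero S.X₂ hU f (f ^ n • b • m - S.f.app U g') (by
      rw [map_sub, map_smul, ← app_map, hg', Hom.app_smul, hg, sub_self])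
    refine ⟨k + n, ?_⟩
    have h0 : S.g.app U (S.f.app U g') = 0 := by
      rw [← AddCommGrpCat.comp_apply, ← Hom.comp_app, S.zero]
      rfl
    have := congrArg (S.g.app U) hk
    rw [Hom.app_smul, map_sub, h0, sub_zero, map_zero, Hom.app_smul, Hom.app_smul] at this
    rw [pow_add, mul_smul, this]
  obtain ⟨q, hq, hqA, h⟩ := exists_mem_Ass_specializes S.X₃ hU (S.g.app U m) key hx ht
  exact ⟨q, hq, hqA, by rwa [stalkSpecializes_germ]⟩

/-! ### The kernel at a minimal associated point. -/

lemma app_app_eq_zero {F G H : X.Modules} {φ : F ⟶ G} {ψ : G ⟶ H} (h : φ ≫ ψ = 0)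
    (U : X.Opens) (s : Γ(F, U)) : ψ.app U (φ.app U s) = 0 := by
  rw [← AddCommGrpCat.comp_apply, ← Hom.comp_app, h]
  rfl

lemma comp_eq_zero_of_app_app_eq_zero {F G H : X.Modules} {φ : F ⟶ G} {ψ : G ⟶ H}
    (h : ∀ (U : X.Opens) (s : Γ(F, U)), ψ.app U (φ.app U s) = 0) : φ ≫ ψ = 0 := by
  ext U s
  exact h U s

lemma pointLT_of_specializes {q p : X} (h : q ⤳ p) (hne : q ≠ p) : PointLT q p := by
  refine ⟨h.closure_subset, fun hle ↦ hne ?_⟩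
  exact h.antisymm (specializes_iff_closure_subset.mpr hle) |>.eq

lemma _root_.IsMinimalAssociatedPoint.eq_of_specializes {F : X.Modules} {p : X}
    (hp : IsMinimalAssociatedPoint F p) {q : X} (hq : q ∈ Ass F) (h : q ⤳ p) : q = p := by
  by_contra hne
  exact hp.2 q hq (pointLT_of_specializes h hne)

/-- At a minimal associated point `p`, the kernel of `F ⟶ i_* i^* F` consists of the sections with
vanishing germ at `p`. -/
lemma toPushforwardPullbackStalk_app_eq_zero_iff [IsLocallyNoetherian X] (F : X.Modules)
    [F.IsQuasicoherent] {p : X} (hp : IsMinimalAssociatedPoint F p) {U : X.Opens} (s : Γ(F, U)) :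
    (toPushforwardPullbackStalk F p).app U s = 0 ↔
      ∀ h : p ∈ U, F.presheaf.germ U p h s = 0 := by
  refine ⟨fun hs ↦ ?_, fun hs ↦ ?_⟩
  · have := germ_eq_zero_of_unit_app_eq_zero (X.fromSpecStalk p)
      (IsLocalRing.closedPoint (X.presheaf.stalk p)) s hs
    rwa [fromSpecStalk_closedPoint] at this
  · refine unit_app_eq_zero_of_germ_eq_zero (X.fromSpecStalk p) s fun z hz ↦ ?_
    have hqp : X.fromSpecStalk p z ⤳ p := by
      have : X.fromSpecStalk p z ∈ Set.range (X.fromSpecStalk p) := ⟨z, rfl⟩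
      rwa [range_fromSpecStalk] at this
    generalize X.fromSpecStalk p z = q at hz hqp
    by_contra hne
    -- From `q' ⤳ q ⤳ p` and minimality, `q' = p`, hence `q = p`, where the germ is zero.
    obtain ⟨q', hq', hA, hne'⟩ := exists_mem_Ass_stalkSpecializes_ne_zero F _ hne
    obtain rfl := hp.eq_of_specializes hA (hq'.trans hqp)
    obtain rfl := (hq'.antisymm hqp).eq
    exact hne (hs hz)

lemma torsionOf_stalkHom {F G : X.Modules} (φ : F ⟶ G) {x : X}
    (h : Function.Injective (stalkHom φ x)) (s : F.presheaf.stalk x) :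
    Ideal.torsionOf _ _ (stalkHom φ x s) = Ideal.torsionOf (X.presheaf.stalk x) _ s := by
  ext a
  rw [Ideal.mem_torsionOf_iff, Ideal.mem_torsionOf_iff, ← (stalkHom φ x).map_smul,
    map_eq_zero_iff _ h]

lemma Ass_subset_of_mono {F G : X.Modules} (φ : F ⟶ G) [Mono φ] : Ass F ⊆ Ass G := by
  rintro x ⟨s, hs⟩
  exact ⟨stalkHom φ x s, (torsionOf_stalkHom φ (stalkHom_injective φ x) s).trans hs⟩

/-- If `p` specializes to `x ≠ p`, some function germ at `x` is invertible at `p` but not at `x`. -/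
lemma exists_mem_maximalIdeal_isUnit_stalkSpecializes {p x : X} (h : p ⤳ x) (hne : p ≠ x) :
    ∃ a ∈ IsLocalRing.maximalIdeal (X.presheaf.stalk x),
      IsUnit ((X.presheaf.stalkSpecializes h).hom a) := by
  have hxp : ¬ x ⤳ p := fun h' ↦ hne (h.antisymm h').eq
  obtain ⟨V, hV, hpV, hxV⟩ := not_specializes_iff_exists_open.mp hxp
  obtain ⟨_, ⟨U, hU, rfl⟩, hxU, -⟩ :=
    X.isBasis_affineOpens.exists_subset_of_mem_open (Set.mem_univ x) isOpen_univ
  have hpU : p ∈ U := h.mem_open U.isOpen hxU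
  obtain ⟨f, hfV, hpf⟩ := hU.exists_basicOpen_le (V := ⟨V, hV⟩) ⟨p, hpV⟩ hpU
  refine ⟨X.presheaf.germ U x hxU f, fun hu ↦ ?_, ?_⟩
  · exact hxV (hfV ((X.mem_basicOpen f x hxU).mpr hu))
  · have : (X.presheaf.stalkSpecializes h).hom (X.presheaf.germ U x hxU f) =
        X.presheaf.germ U p hpU f :=
      ConcreteCategory.congr_hom (X.presheaf.germ_stalkSpecializes hxU h) f
    rw [this]
    exact (X.mem_basicOpen f p hpU).mp hpf

lemma stalkSpecializes_eq_zero_of_smul {F : X.Modules} {p x : X} (h : p ⤳ x)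
    {a : X.presheaf.stalk x} (ha : IsUnit ((X.presheaf.stalkSpecializes h).hom a))
    {t : F.presheaf.stalk x} (hat : stalkSpecializes F h (a • t) = 0) :
    stalkSpecializes F h t = 0 := by
  rw [map_smulₛₗ] at hat
  exact ha.smul_eq_zero.mp hat

lemma stalkSpecializes_refl (F : X.Modules) {p : X} (t : F.presheaf.stalk p) :
    stalkSpecializes F (specializes_refl p) t = t := by
  obtain ⟨U, hU, t, rfl⟩ := F.presheaf.exists_germ_eq t
  rw [stalkSpecializes_germ]

/-! ### Associated points of the submodule of sections vanishing at `p`, and of its quotient. -/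

section

variable {S : ShortComplex X.Modules} (hS : S.ShortExact) {p : X}
  (h : ∀ (U : X.Opens) (s : Γ(S.X₂, U)),
    (∃ t, S.f.app U t = s) ↔ ∀ hp : p ∈ U, S.X₂.presheaf.germ U p hp s = 0)

include h

/-- If `x` is not a specialization of `p`, it has a neighbourhood missing `p`, on which `h` imposes
no condition. -/
lemma mem_range_stalkHom_iff {x : X} (t : S.X₂.presheaf.stalk x) :
    (∃ g, stalkHom S.f x g = t) ↔ ∀ hx : p ⤳ x, stalkSpecializes S.X₂ hx t = 0 := by
  refine ⟨?_, fun ht ↦ ?_⟩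
  · rintro ⟨g, rfl⟩ hx
    obtain ⟨U, hU, g, rfl⟩ := S.X₁.presheaf.exists_germ_eq g
    rw [stalkHom_germ, stalkSpecializes_germ]
    exact (h U _).mp ⟨g, rfl⟩ _
  · obtain ⟨U, hU, t, rfl⟩ := S.X₂.presheaf.exists_germ_eq t
    by_cases hx : p ⤳ x
    · obtain ⟨g, rfl⟩ := (h U t).mpr fun hp ↦ by simpa using ht hx
      exact ⟨S.X₁.presheaf.germ U x hU g, stalkHom_germ _ _ _⟩
    · obtain ⟨V, hV, hxV, hpV⟩ := not_specializes_iff_exists_open.mp hx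
      let W : X.Opens := U ⊓ ⟨V, hV⟩
      have hxW : x ∈ W := ⟨hU, hxV⟩
      obtain ⟨g, hg⟩ := (h W (S.X₂.presheaf.map (homOfLE inf_le_left).op t)).mpr
        fun hp ↦ (hpV hp.2).elim
      refine ⟨S.X₁.presheaf.germ W x hxW g, ?_⟩
      rw [stalkHom_germ, hg, S.X₂.presheaf.germ_res_apply]

include hS

lemma stalkHom_eq_zero_iff {x : X} (t : S.X₂.presheaf.stalk x) :
    stalkHom S.g x t = 0 ↔ ∀ hx : p ⤳ x, stalkSpecializes S.X₂ hx t = 0 := by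
  have := hS.mono_f
  rw [← mem_range_stalkHom_iff h]
  refine ⟨fun ht ↦ exists_stalkHom_eq_of_stalkHom_eq_zero hS.exact t ht, ?_⟩
  rintro ⟨g, rfl⟩
  obtain ⟨U, hU, g, rfl⟩ := S.X₁.presheaf.exists_germ_eq g
  rw [stalkHom_germ, stalkHom_germ, app_app_eq_zero S.zero, map_zero]

/-- A germ of the quotient with annihilator the maximal ideal at `x ≠ p` would be killed by an
element invertible at `p`, hence be zero. At `p` the quotient map is injective on stalks. -/
lemma Ass_quotient_eq_singleton (hp : p ∈ Ass S.X₂) : Ass S.X₃ = {p} := by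
  have := hS.epi_g
  ext x
  rw [Set.mem_singleton_iff]
  constructor
  · rintro ⟨t, ht⟩
    obtain ⟨t, rfl⟩ := stalkHom_surjective S.g x t
    have hmem (a : X.presheaf.stalk x) : stalkHom S.g x (a • t) = 0 ↔
        a ∈ IsLocalRing.maximalIdeal (X.presheaf.stalk x) := by
      rw [← ht, Ideal.mem_torsionOf_iff, (stalkHom S.g x).map_smul]
    have h1 : stalkHom S.g x t ≠ 0 := fun h0 ↦
      (IsLocalRing.maximalIdeal.isMaximal (X.presheaf.stalk x)).ne_top
        ((Ideal.eq_top_iff_one _).mpr ((hmem 1).mp (by rwa [one_smul])))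
    rw [Ne, stalkHom_eq_zero_iff hS h] at h1
    push Not at h1
    obtain ⟨hx, h1⟩ := h1
    by_contra hne
    obtain ⟨a, ha, hau⟩ := exists_mem_maximalIdeal_isUnit_stalkSpecializes hx (Ne.symm hne)
    exact h1 (stalkSpecializes_eq_zero_of_smul hx hau
      ((stalkHom_eq_zero_iff hS h _).mp ((hmem a).mpr ha) hx))
  · rintro rfl
    obtain ⟨s, hs⟩ := hp
    refine ⟨stalkHom S.g x s, (torsionOf_stalkHom S.g ?_ s).trans hs⟩
    rw [← LinearMap.ker_eq_bot, LinearMap.ker_eq_bot']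
    intro t ht
    rw [← stalkSpecializes_refl S.X₂ t]
    exact (stalkHom_eq_zero_iff hS h t).mp ht _

/-- The stalk of the submodule at `p` is zero. At `x ≠ p`, a germ killed by the maximal ideal
vanishes at `p` whenever `p ⤳ x`, so it already lies in the submodule. -/
lemma Ass_sub_eq_diff : Ass S.X₁ = Ass S.X₂ \ {p} := by
  have := hS.mono_f
  ext x
  constructor
  · intro hx
    refine ⟨Ass_subset_of_mono S.f hx, ?_⟩
    rintro rfl
    obtain ⟨s, hs⟩ := hx
    have h0 := (mem_range_stalkHom_iff h (stalkHom S.f x s)).mp ⟨s, rfl⟩ (specializes_refl x)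
    rw [stalkSpecializes_refl, map_eq_zero_iff _ (stalkHom_injective S.f x)] at h0
    rw [h0, Ideal.torsionOf_zero] at hs
    exact (IsLocalRing.maximalIdeal.isMaximal (X.presheaf.stalk x)).ne_top hs.symm
  · rintro ⟨⟨t, ht⟩, hne⟩
    obtain ⟨g, rfl⟩ := (mem_range_stalkHom_iff h t).mpr fun hx ↦ by
      obtain ⟨a, ha, hau⟩ := exists_mem_maximalIdeal_isUnit_stalkSpecializes hx (Ne.symm hne)
      rw [← ht, Ideal.mem_torsionOf_iff] at ha
      exact stalkSpecializes_eq_zero_of_smul hx hau (by rw [ha, map_zero])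
    exact ⟨g, (torsionOf_stalkHom S.f (stalkHom_injective S.f x) g).symm.trans ht⟩

end

/-! ### Recovering the submodule from its associated points. -/

/-- A section of the quotient of quasi-coherent modules vanishes if its germ at the only associated
point of the quotient does. -/
lemma eq_zero_of_germ_eq_zero_of_Ass_eq_singleton [IsLocallyNoetherian X]
    {S : ShortComplex X.Modules} (hS : S.ShortExact) [S.X₁.IsQuasicoherent]
    [S.X₂.IsQuasicoherent] {p : X} (hA : Ass S.X₃ = {p}) {U : X.Opens} (t : Γ(S.X₃, U))
    (ht : ∀ h : p ∈ U, S.X₃.presheaf.germ U p h t = 0) : t = 0 := by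
  refine eq_zero_of_germ_eq_zero _ _ fun x hx ↦ ?_
  by_contra hne
  obtain ⟨q, hq, hqA, h⟩ := exists_mem_Ass_stalkSpecializes_ne_zero_of_shortExact hS _ hne
  rw [hA, Set.mem_singleton_iff] at hqA
  subst hqA
  rw [stalkSpecializes_germ] at h
  exact h (ht _)

lemma germ_eq_zero_of_Ass_subset [IsLocallyNoetherian X] {F G : X.Modules} [G.IsQuasicoherent]
    {p : X} (hp : IsMinimalAssociatedPoint F p) (hG : Ass G ⊆ Ass F \ {p}) {U : X.Opens}
    (t : Γ(G, U)) (h : p ∈ U) : G.presheaf.germ U p h t = 0 := by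
  by_contra hne
  obtain ⟨q, hq, hqA, -⟩ := exists_mem_Ass_stalkSpecializes_ne_zero G _ hne
  exact (hG hqA).2 (hp.eq_of_specializes (hG hqA).1 hq)

end AlgebraicGeometry.Scheme.Modules

open AlgebraicGeometry.Scheme.Modules in
theorem lemma3p2 {X : Scheme.{u}} [IsLocallyNoetherian X]
    (F : X.Modules) (hF : F.IsQuasicoherent)
    (p : X) (hp : IsMinimalAssociatedPoint F p)
    (G : Subobject F) (hG : (G : X.Modules).IsQuasicoherent) :
    G = kernelSubobject (toPushforwardPullbackStalk F p) ↔
      Ass (cokernel G.arrow) = {p} ∧ Ass (G : X.Modules) = Ass F \ {p} := by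
  let φ := toPushforwardPullbackStalk F p
  let S : ShortComplex X.Modules := ShortComplex.mk G.arrow (cokernel.π G.arrow) (by simp)
  have hS : S.ShortExact :=
    { exact := ShortComplex.exact_cokernel G.arrow
      mono_f := inferInstanceAs (Mono G.arrow)
      epi_g := inferInstanceAs (Epi (cokernel.π G.arrow)) }
  have : S.X₁.IsQuasicoherent := hG
  have : S.X₂.IsQuasicoherent := hF
  constructor
  · intro hGK
    have h (U : X.Opens) (s : Γ(F, U)) : (∃ t, G.arrow.app U t = s) ↔
        ∀ h : p ∈ U, F.presheaf.germ U p h s = 0 := by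
      rw [← toPushforwardPullbackStalk_app_eq_zero_iff F hp]
      have h0 : G.arrow ≫ φ = 0 := by rw [hGK]; exact kernelSubobject_arrow_comp φ
      constructor
      · rintro ⟨t, rfl⟩
        exact app_app_eq_zero h0 U t
      -- As `G` is the kernel subobject, left exactness of sections lifts any section killed by `φ`
      -- to `G`.
      · have hex : (ShortComplex.mk G.arrow φ h0).Exact := by
          rw [ShortComplex.exact_iff_image_eq_kernel, imageSubobject_mono, Subobject.mk_arrow]
          exact hGK
        have : Mono (ShortComplex.mk G.arrow φ h0).f := inferInstanceAs (Mono G.arrow)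
        exact exists_app_eq_of_app_eq_zero hex s
    exact ⟨Ass_quotient_eq_singleton hS h hp.1, Ass_sub_eq_diff hS h⟩
  · rintro ⟨h1, h2⟩
    apply le_antisymm
    · apply le_kernelSubobject
      refine comp_eq_zero_of_app_app_eq_zero fun U t ↦ ?_
      refine (toPushforwardPullbackStalk_app_eq_zero_iff F hp _).mpr fun h ↦ ?_
      rw [← stalkHom_germ, germ_eq_zero_of_Ass_subset hp h2.le, map_zero]
    · have h0 : (kernelSubobject φ).arrow ≫ cokernel.π G.arrow = 0 := by
        refine comp_eq_zero_of_app_app_eq_zero fun U t ↦ ?_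
        refine eq_zero_of_germ_eq_zero_of_Ass_eq_singleton hS h1 _ fun h ↦ ?_
        have ht := app_app_eq_zero (kernelSubobject_arrow_comp φ) U t
        have := (toPushforwardPullbackStalk_app_eq_zero_iff F hp _).mp ht h
        refine (stalkHom_germ (cokernel.π G.arrow) h _).symm.trans ?_
        rw [this, map_zero]
      exact Subobject.le_of_comm (hS.exact.lift _ h0) (hS.exact.lift_f _ h0)
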